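/- Let $V$ be a finite-dimensional real inner product space and let $\Sigma\subset V$ be a (possibly non-reduced) abstract root system, that is, a finite set of non-zero vectors spanning $V$ such that, for all $\alpha,\beta\in\Sigma$, the number $A_{\alpha,\beta}=2\langle\alpha,\beta\rangle/|\alpha|^2$ is an integer and $\beta-A_{\alpha,\beta}\,\alpha\in\Sigma$. Let $\Sigma^+$ be the set of positive roots, i.e. the roots in one of the two open half-spaces determined by a hyperplane of $V$ containing no root, and let $\Pi$ be the corresponding set of simple roots, i.e. the positive roots that are not a sum of two positive roots; $\Pi$ is a basis of $V$. The level of $v=\sum_{\alpha\in\Pi}n_\alpha\alpha$ is $\sum_{\alpha\in\Pi} n_\alpha$. For $\Phi\subset\Pi$ and a root $\lambda$, the $\Phi$-string $I_\Phi^\lambda$ of $\lambda$ is the set of all elements of $\Sigma\cup\{0\}$ of the form $\lambda+\sum_{\alpha\in\Phi}n_\alpha\alpha$ with $n_\alpha\in\mathbb{Z}$. A root is said to be of minimum level in its $\Phi$-string if no root of that string has smaller level. Let $\Sigma^\Phi=\Sigma^+\setminus\operatorname{span}_{\mathbb Z}\Phi$ be the set of positive roots not spanned by $\Phi$. A subset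 of $\Pi$ is connected if it is not the union of two non-empty subsets such that every element of the first is orthogonal to every element of the second. Let $\Phi_1,\dots,\Phi_n$ ($n\ge 1$) be connected and mutually orthogonal subsets of $\Pi$, put $\Phi=\Phi_1\cup\dots\cup\Phi_n$, and assume that $\Phi$ is a proper subset of $\Pi$. Let $\lambda\in\Sigma^\Phi$ be of minimum level in its $\Phi$-string. Then: (i) $I_{\Phi_k}^\lambda\subset\Sigma^+$ for all $k=1,\dots,n$, and $$I_\Phi^\lambda=\Big\{\lambda+\sum_{k=1}^n\gamma_k \;:\; \gamma_k\in\operatorname{span}\Phi_k \text{ and } \lambda+\gamma_k\in I_{\Phi_k}^\lambda \text{ for all } k=1,\dots,n\Big\}.$$ (ii) A root $\gamma\in\Sigma^\Phi$ is of minimum level in its $\Phi$-string if and only if it is of minimum level in its $\Phi_k$-string for each $k\in\{1,\dots,n\}$. -/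

import Mathlib

open scoped InnerProductSpace

/-- An abstract (possibly non-reduced) root system in a Euclidean space `V`: a finite set of
non-zero vectors spanning `V`, such that the Cartan numbers
`A_{α,β} = 2⟪α, β⟫ / |α|²` are integers and the set is stable under the reflections
`β ↦ β - A_{α,β} α`. -/
structure AbstractRootSystem (V : Type*) [NormedAddCommGroup V] [InnerProductSpace ℝ V] where
  roots : Set V
  finite_roots : roots.Finite
  zero_notMem : (0 : V) ∉ roots
  span_roots : Submodule.span ℝ roots = ⊤
  cartan_integer : ∀ α ∈ roots, ∀ β ∈ roots, ∃ z : ℤ, 2 * ⟪α, β⟫_ℝ / ‖α‖ ^ 2 = z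
  reflection_mem : ∀ α ∈ roots, ∀ β ∈ roots, β - (2 * ⟪α, β⟫_ℝ / ‖α‖ ^ 2) • α ∈ roots

namespace AbstractRootSystem

/-- A positivity criterion on a root system: one of the two half-spaces `{v | 0 < functional v}`
determined by the hyperplane `{v | functional v = 0}`, which contains no root. -/
structure Positivity {V : Type*} [NormedAddCommGroup V] [InnerProductSpace ℝ V]
    (S : AbstractRootSystem V) where
  functional : V →ₗ[ℝ] ℝ
  functional_ne_zero : ∀ α ∈ S.roots, functional α ≠ 0

section

variable {V : Type*} [NormedAddCommGroup V] [InnerProductSpace ℝ V] {S : AbstractRootSystem V}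

/-- The set `Σ⁺` of positive roots. -/
def Positivity.positive (P : S.Positivity) : Set V :=
  {α | α ∈ S.roots ∧ 0 < P.functional α}

/-- The set `Π` of simple roots: the positive roots that are not a sum of two positive roots. -/
def Positivity.simple (P : S.Positivity) : Set V :=
  {α | α ∈ P.positive ∧ ¬ ∃ β ∈ P.positive, ∃ γ ∈ P.positive, α = β + γ}

theorem neg_mem {α : V} (hα : α ∈ S.roots) : -α ∈ S.roots := by
  have h := S.reflection_mem α hα α hα
  have h0 : α ≠ 0 := fun h => S.zero_notMem (h ▸ hα)
  have h1 : ‖α‖ ≠ 0 := norm_ne_zero_iff.mpr h0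
  rw [real_inner_self_eq_norm_sq, mul_div_assoc, div_self (pow_ne_zero 2 h1), mul_one, two_smul]
    at h
  simpa using h

theorem sub_mem_of_inner_pos {α β : V} (hα : α ∈ S.roots) (hβ : β ∈ S.roots)
    (hne : α ≠ β) (hpos : 0 < ⟪α, β⟫_ℝ) : α - β ∈ S.roots := by
  obtain ⟨a, ha⟩ := S.cartan_integer α hα β hβ
  obtain ⟨b, hb⟩ := S.cartan_integer β hβ α hα
  have ra := S.reflection_mem α hα β hβ
  have rb := S.reflection_mem β hβ α hα
  have hα0 : 0 < ‖α‖ ^ 2 := pow_pos (norm_pos_iff.mpr fun h => S.zero_notMem (h ▸ hα)) 2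
  have hβ0 : 0 < ‖β‖ ^ 2 := pow_pos (norm_pos_iff.mpr fun h => S.zero_notMem (h ▸ hβ)) 2
  rw [real_inner_comm] at hb rb
  rw [ha] at ra
  rw [hb] at rb
  have ea : 2 * ⟪α, β⟫_ℝ = a * ‖α‖ ^ 2 := by rw [← ha, div_mul_cancel₀ _ hα0.ne']
  have eb : 2 * ⟪α, β⟫_ℝ = b * ‖β‖ ^ 2 := by rw [← hb, div_mul_cancel₀ _ hβ0.ne']
  have ha0 : (0 : ℝ) < a := by rw [← ha]; positivity
  have hb0 : (0 : ℝ) < b := by rw [← hb]; positivity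
  have ha1 : 0 < a := by exact_mod_cast ha0
  have hb1 : 0 < b := by exact_mod_cast hb0
  by_cases h1 : a = 1
  · have := S.neg_mem ra
    simpa [h1] using this
  by_cases h2 : b = 1
  · simpa [h2] using rb
  exfalso
  have ha2 : (2 : ℝ) ≤ a := by exact_mod_cast (show (2 : ℤ) ≤ a by omega)
  have hb2 : (2 : ℝ) ≤ b := by exact_mod_cast (show (2 : ℤ) ≤ b by omega)
  have hn : ‖α - β‖ ^ 2 ≤ 0 := by
    rw [norm_sub_sq_real]
    nlinarith
  have : ‖α - β‖ = 0 := by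
    have := sq_nonneg ‖α - β‖
    exact pow_eq_zero_iff (two_ne_zero) |>.mp (le_antisymm hn this)
  exact hne (sub_eq_zero.mp (norm_eq_zero.mp this))

theorem Positivity.inner_simple_nonpos (P : S.Positivity) {α β : V} (hα : α ∈ P.simple)
    (hβ : β ∈ P.simple) (hne : α ≠ β) : ⟪α, β⟫_ℝ ≤ 0 := by
  by_contra! h
  have h1 := S.sub_mem_of_inner_pos hα.1.1 hβ.1.1 hne h
  have h2 := S.neg_mem h1
  rw [neg_sub] at h2
  rcases lt_or_gt_of_ne (P.functional_ne_zero _ h1) with h3 | h3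
  · refine hβ.2 ⟨β - α, ⟨h2, ?_⟩, α, hα.1, by simp⟩
    simp only [map_sub] at h3 ⊢
    linarith
  · exact hα.2 ⟨α - β, ⟨h1, h3⟩, β, hβ.1, by simp⟩

theorem Positivity.linearIndependent_simple (P : S.Positivity) :
    LinearIndependent ℝ (fun α : P.simple => (α : V)) := by
  have : Finite P.simple := S.finite_roots.subset fun α hα => hα.1.1
  have : Fintype P.simple := Fintype.ofFinite _
  refine LinearMap.BilinForm.linearIndependent_of_pairwise_le_zero (innerₗ V) ?_ P.functional _
    (fun α => α.2.1.2) ?_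
  · intro x hx
    have h : x ≠ 0 := by simpa using hx
    simpa using pow_pos (norm_pos_iff.mpr h) 2
  · intro α β hne
    exact P.inner_simple_nonpos α.2 β.2 (fun h => hne (Subtype.ext h))

/-- Every positive root is a sum of simple roots. -/
theorem Positivity.positive_subset_closure (P : S.Positivity) :
    P.positive ⊆ AddSubmonoid.closure P.simple := by
  by_contra hcon
  obtain ⟨α₀, h₀, h₀'⟩ := Set.not_subset.mp hcon
  let T : Set V := {α | α ∈ P.positive ∧ α ∉ AddSubmonoid.closure P.simple}
  have hT : T.Finite := S.finite_roots.subset fun α hα => hα.1.1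
  obtain ⟨α, hα, hmin⟩ := Set.exists_min_image T P.functional hT ⟨α₀, h₀, h₀'⟩
  have hns : α ∉ P.simple := fun h => hα.2 (AddSubmonoid.subset_closure h)
  obtain ⟨β, hβ, γ, hγ, rfl⟩ : ∃ β ∈ P.positive, ∃ γ ∈ P.positive, α = β + γ := by
    by_contra h
    exact hns ⟨hα.1, h⟩
  have key : ∀ δ ∈ P.positive, P.functional δ < P.functional (β + γ) →
      δ ∈ AddSubmonoid.closure P.simple := by
    intro δ hδ hlt
    by_contra h
    exact absurd (hmin δ ⟨hδ, h⟩) (not_le.mpr hlt)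
  refine hα.2 (add_mem (key β hβ ?_) (key γ hγ ?_))
  · have := hγ.2
    simp only [map_add]; linarith
  · have := hβ.2
    simp only [map_add]; linarith

theorem Positivity.span_simple (P : S.Positivity) :
    ⊤ ≤ Submodule.span ℝ (Set.range fun α : P.simple => (α : V)) := by
  rw [Subtype.range_coe, ← S.span_roots, Submodule.span_le]
  have hpos : P.positive ⊆ Submodule.span ℝ P.simple := fun α hα =>
    (AddSubmonoid.closure_le (S := (Submodule.span ℝ P.simple).toAddSubmonoid)).mpr
      Submodule.subset_span (P.positive_subset_closure hα)
  intro α hα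
  rcases lt_or_gt_of_ne (P.functional_ne_zero _ hα) with h | h
  · have : -α ∈ Submodule.span ℝ P.simple := hpos ⟨S.neg_mem hα, by simpa using h⟩
    simpa using this
  · exact hpos ⟨hα, h⟩

/-- The simple roots, as a basis of `V`. -/
noncomputable def Positivity.simpleBasis (P : S.Positivity) : Module.Basis P.simple ℝ V :=
  Module.Basis.mk P.linearIndependent_simple P.span_simple

/-- The level `l(v) = ∑ n_α` of `v = ∑ n_α α`, the sums running over the simple roots `α`. -/
noncomputable def Positivity.level (P : S.Positivity) (v : V) : ℝ :=
  (P.simpleBasis.repr v).sum fun _ c => c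

/-- The level of an integral combination of simple roots is the sum of its coefficients. -/
theorem Positivity.level_sum (P : S.Positivity) (Φ : Finset V) (hΦ : (Φ : Set V) ⊆ P.simple)
    (n : V → ℤ) : P.level (∑ α ∈ Φ, n α • α) = ∑ α ∈ Φ, (n α : ℝ) := by
  let L : V →ₗ[ℝ] ℝ :=
    (Finsupp.linearCombination ℝ fun _ : P.simple => (1 : ℝ)) ∘ₗ P.simpleBasis.repr.toLinearMap
  have hL : ∀ v, P.level v = L v := fun v => by
    simp [L, Positivity.level, Finsupp.linearCombination_apply]
  rw [hL, map_sum]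
  refine Finset.sum_congr rfl fun α hα => ?_
  have hα' : P.simpleBasis ⟨α, hΦ hα⟩ = α := by simp [Positivity.simpleBasis]
  have h1 : L α = 1 := by
    rw [← hL, Positivity.level]
    conv_lhs => rw [← hα']
    rw [Module.Basis.repr_self]
    simp
  rw [map_zsmul, h1]
  simp

/-- The `Φ`-string `I_Φ^lam`: the elements of `Σ ∪ {0}` of the form `lam + ∑_{α ∈ Φ} n_α α` with
integers `n_α`. -/
def string (S : AbstractRootSystem V) (Φ : Finset V) (lam : V) : Set V :=
  {μ | μ ∈ S.roots ∪ {0} ∧ ∃ n : V → ℤ, μ = lam + ∑ α ∈ Φ, n α • α}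

/-- The root subsystem `Σ_Φ = span_ℤ Φ ∩ Σ`. -/
def spanned (S : AbstractRootSystem V) (Φ : Finset V) : Set V :=
  {α | α ∈ S.roots ∧ α ∈ Submodule.span ℤ (Φ : Set V)}

/-- The set `Σ^Φ` of positive roots that are not spanned by `Φ`. -/
def Positivity.notSpanned (P : S.Positivity) (Φ : Finset V) : Set V :=
  P.positive \ S.spanned Φ

/-- The root `γ` is of minimum level in its `Φ`-string. -/
def Positivity.IsMinLevel (P : S.Positivity) (Φ : Finset V) (γ : V) : Prop :=
  γ ∈ S.roots ∧ ∀ μ ∈ S.string Φ γ, μ ∈ S.roots → P.level γ ≤ P.level μ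

/-- A set of simple roots is connected if it is not the union of two non-empty subsets such that
every element of the first is orthogonal to every element of the second. -/
def IsConnectedSubset (Φ : Set V) : Prop :=
  ¬ ∃ A B : Set V, A.Nonempty ∧ B.Nonempty ∧ Φ = A ∪ B ∧ ∀ α ∈ A, ∀ β ∈ B, ⟪α, β⟫_ℝ = 0

end

end AbstractRootSystem

/-!
Fix a set `A` of simple roots and a root `γ` outside the real span of `A`. The proof replaces
minimality of the level by a local condition: `γ` is *lowest* for `A` if no `γ - α`, `α ∈ A`, is a
root. A lowest root pairs nonpositively with `A`.

The key point is that `γ + span A` contains at most one lowest root (`IsLowest.eq`). If `γ` and `ν`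
are both lowest, they have the same non-zero component orthogonal to `span A`, and their components
in `span A` are both antidominant; antidominant vectors in the span of an obtuse set pair
nonnegatively, so `⟪γ, ν⟫ > 0`, and `γ - ν`, if not zero, is a root in `span A`. Say it is a
positive root `p`. As `γ - p` is a root, simple roots can be peeled off `p` one at a time until
`γ - α` is a root for a simple `α ∈ A` (`exists_sub_simple_mem`), a contradiction.

Consequently, from every root of `γ + span A` other than the lowest root `γ` one can subtract some
element of `A`, and statements about these roots can be proved by induction starting from `γ`
(`IsLowest.induction`). A first application is that being of minimum level in a string is the same
as being lowest (`isMinLevel_iff_isLowest`). The local condition for `Φ = ⋃ Φ_k` is visibly the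
conjunction of those for the `Φ_k`, which is part (ii).

A second application is the description of the string. In the inductive step `ν - α` is a root,
and one concludes for `ν` either by reflecting in `α` or by adding `α`. Both operations depend only
on `⟪α, ν⟫`, and therefore are compatible with a translation orthogonal to `α`
(`add_mem_roots_of_orthogonal`). Hence the component of a root along one `Φ_k` can be added
(`IsLowest.add_add_mem`) or isolated (`IsLowest.add_mem_of_add_add_mem`) independently of the
components along the others.
-/

open Submodule in
/-- For a set `A` of vectors with pairwise nonpositive inner products, an antidominant vector of
`span A` is a nonpositive combination of `A`, so that it pairs nonnegatively with every antidominant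
vector. -/
theorem inner_nonneg_of_mem_span_of_antidominant {V : Type*} [NormedAddCommGroup V]
    [InnerProductSpace ℝ V] {A : Set V} (hA : ∀ α ∈ A, ∀ β ∈ A, α ≠ β → ⟪α, β⟫_ℝ ≤ 0)
    {x y : V} (hx : x ∈ span ℝ A) (hxA : ∀ α ∈ A, ⟪x, α⟫_ℝ ≤ 0) (hyA : ∀ α ∈ A, ⟪y, α⟫_ℝ ≤ 0) :
    0 ≤ ⟪x, y⟫_ℝ := by
  obtain ⟨c, t, ht, -, rfl⟩ := mem_span_iff_exists_finset_subset.mp hx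
  set p := ∑ a ∈ t, max (c a) 0 • a with hp
  set q := ∑ a ∈ t, max (-c a) 0 • a with hq
  have hsplit : ∑ a ∈ t, c a • a = p - q := by
    rw [hp, hq, ← Finset.sum_sub_distrib]
    refine Finset.sum_congr rfl fun a _ => ?_
    rw [← sub_smul]
    congr 1
    rcases le_total (c a) 0 with h | h
    · rw [max_eq_right h, max_eq_left (by linarith)]; ring
    · rw [max_eq_left h, max_eq_right (by linarith)]; ring
  have hqp : ⟪q, p⟫_ℝ ≤ 0 := by
    rw [hp, hq, sum_inner]
    refine Finset.sum_nonpos fun a ha => ?_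
    rw [inner_sum]
    refine Finset.sum_nonpos fun b hb => ?_
    rw [real_inner_smul_left, real_inner_smul_right]
    by_cases hab : a = b
    · subst hab
      rcases le_total (c a) 0 with h | h
      · simp [max_eq_right h]
      · simp [max_eq_right (neg_nonpos.mpr h)]
    · exact mul_nonpos_of_nonneg_of_nonpos (le_max_right _ _)
        (mul_nonpos_of_nonneg_of_nonpos (le_max_right _ _) (hA a (ht ha) b (ht hb) hab))
  rw [hsplit] at hxA ⊢
  have hxp : ⟪p - q, p⟫_ℝ ≤ 0 := by
    rw [hp, inner_sum, ← hp]
    refine Finset.sum_nonpos fun a ha => ?_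
    rw [real_inner_smul_right]
    exact mul_nonpos_of_nonneg_of_nonpos (le_max_right _ _) (hxA a (ht ha))
  -- `‖p‖² = ⟪p - q, p⟫ + ⟪q, p⟫ ≤ 0`, so that only the part with negative coefficients remains
  have hp0 : p = 0 := by
    rw [inner_sub_left] at hxp
    exact real_inner_self_nonpos.mp (by linarith : ⟪p, p⟫_ℝ ≤ 0)
  rw [hp0, zero_sub, inner_neg_left, hq, sum_inner, neg_nonneg]
  refine Finset.sum_nonpos fun a ha => ?_
  rw [real_inner_smul_left, real_inner_comm]
  exact mul_nonpos_of_nonneg_of_nonpos (le_max_right _ _) (hyA a (ht ha))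

namespace AbstractRootSystem

variable {V : Type*} [NormedAddCommGroup V] [InnerProductSpace ℝ V] {S : AbstractRootSystem V}

/-! ### Sums and differences of roots -/

theorem add_mem_of_inner_neg {α β : V} (hα : α ∈ S.roots) (hβ : β ∈ S.roots)
    (hne : β ≠ -α) (hneg : ⟪α, β⟫_ℝ < 0) : β + α ∈ S.roots := by
  have := S.sub_mem_of_inner_pos hβ (neg_mem hα) hne
    (by rw [inner_neg_right, real_inner_comm]; linarith)
  simpa using this

/-- Membership in the root system is transported along a translation by `b`, orthogonal to the
root `α`, if it is transported strictly below along `α`: one reaches `ν` and `ν + b` from below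
both by adding `α` or both by reflecting in `α`. -/
theorem add_mem_roots_of_orthogonal {α ν b : V} (hα : α ∈ S.roots) (hb : ⟪α, b⟫_ℝ = 0)
    (hν : ν ∈ S.roots) (hνα : ν - α ∈ S.roots) (h0 : ν + b ≠ 0)
    (h : ∀ c : ℝ, 0 < c → ν - c • α ∈ S.roots → ν - c • α + b ∈ S.roots) :
    ν + b ∈ S.roots := by
  have hα0 : 0 < ‖α‖ ^ 2 := pow_pos (norm_pos_iff.mpr fun h => S.zero_notMem (h ▸ hα)) 2
  rcases le_or_gt ⟪α, ν⟫_ℝ 0 with hle | hgt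
  · have h1 := h 1 one_pos (by simpa using hνα)
    rw [one_smul] at h1
    have h2 : ⟪α, ν - α + b⟫_ℝ < 0 := by
      rw [inner_add_right, inner_sub_right, real_inner_self_eq_norm_sq, hb]; linarith
    have h3 : ν - α + b ≠ -α := fun e => h0 <| by
      have : ν + b = (ν - α + b) + α := by abel
      rw [this, e, neg_add_cancel]
    have := add_mem_of_inner_neg hα h1 h3 h2
    rwa [show ν - α + b + α = ν + b by abel] at this
  · have h1 := h _ (by positivity) (S.reflection_mem α hα ν hν)
    have h2 := S.reflection_mem α hα _ h1
    have h3 : 2 * ⟪α, ν - (2 * ⟪α, ν⟫_ℝ / ‖α‖ ^ 2) • α + b⟫_ℝ / ‖α‖ ^ 2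
        = -(2 * ⟪α, ν⟫_ℝ / ‖α‖ ^ 2) := by
      rw [inner_add_right, inner_sub_right, real_inner_smul_right, real_inner_self_eq_norm_sq, hb,
        div_mul_cancel₀ _ hα0.ne']
      ring
    rw [h3] at h2
    convert h2 using 1
    module

/-! ### Spans of sets of simple roots -/

theorem closure_le_span (B : Set V) :
    AddSubmonoid.closure B ≤ (Submodule.span ℝ B).toAddSubmonoid :=
  (AddSubmonoid.closure_le (S := (Submodule.span ℝ B).toAddSubmonoid)).mpr Submodule.subset_span

section Span

variable (P : S.Positivity) {A : Set V}

theorem Positivity.disjoint_span_simple_diff (hA : A ⊆ P.simple) :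
    Disjoint (Submodule.span ℝ A) (Submodule.span ℝ (P.simple \ A)) := by
  have h := P.linearIndependent_simple.disjoint_span_image
    (s := Subtype.val ⁻¹' A) (t := Subtype.val ⁻¹' (P.simple \ A))
    (disjoint_sdiff_self_right.preimage _)
  rwa [Subtype.image_preimage_coe, Subtype.image_preimage_coe, Set.inter_eq_right.mpr hA,
    Set.inter_eq_right.mpr Set.sdiff_subset] at h

theorem Positivity.mem_closure_of_mem_span (hA : A ⊆ P.simple) {x : V}
    (hx : x ∈ AddSubmonoid.closure P.simple) (hxA : x ∈ Submodule.span ℝ A) :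
    x ∈ AddSubmonoid.closure A := by
  rw [← Set.union_sdiff_cancel hA, AddSubmonoid.closure_union] at hx
  obtain ⟨y, hy, z, hz, rfl⟩ := AddSubmonoid.mem_sup.mp hx
  have hz0 : z = 0 := Submodule.disjoint_def.mp (P.disjoint_span_simple_diff hA) z
    (by simpa using sub_mem hxA (closure_le_span A hy))
    (closure_le_span _ hz)
  simpa [hz0] using hy

theorem Positivity.mem_int_span_of_mem_span (hA : A ⊆ P.simple) {x : V}
    (hx : x ∈ Submodule.span ℤ P.simple) (hxA : x ∈ Submodule.span ℝ A) :
    x ∈ Submodule.span ℤ A := by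
  have hle : ∀ B : Set V, ∀ v ∈ Submodule.span ℤ B, v ∈ Submodule.span ℝ B :=
    fun B v hv => Submodule.span_subset_span ℤ ℝ B hv
  rw [← Set.union_sdiff_cancel hA, Submodule.span_union] at hx
  obtain ⟨y, hy, z, hz, rfl⟩ := Submodule.mem_sup.mp hx
  have hz0 : z = 0 := Submodule.disjoint_def.mp (P.disjoint_span_simple_diff hA) z
    (by simpa using sub_mem hxA (hle A y hy)) (hle _ z hz)
  simpa [hz0] using hy

theorem Positivity.neg_mem_positive {α : V} (hα : α ∈ S.roots) (h : α ∉ P.positive) :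
    -α ∈ P.positive := by
  refine ⟨neg_mem hα, ?_⟩
  have h1 := P.functional_ne_zero α hα
  have h2 : ¬ 0 < P.functional α := fun h' => h ⟨hα, h'⟩
  rw [map_neg]
  rcases lt_or_gt_of_ne h1 with h3 | h3
  · linarith
  · exact absurd h3 h2

theorem Positivity.roots_subset_int_span : S.roots ⊆ Submodule.span ℤ P.simple := by
  have hpos : P.positive ⊆ Submodule.span ℤ P.simple := fun α hα =>
    (AddSubmonoid.closure_le (S := (Submodule.span ℤ P.simple).toAddSubmonoid)).mpr
      Submodule.subset_span (P.positive_subset_closure hα)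
  intro α hα
  by_cases h : α ∈ P.positive
  · exact hpos h
  · simpa using hpos (P.neg_mem_positive hα h)

theorem Positivity.eq_zero_or_functional_pos {x : V} (hx : x ∈ AddSubmonoid.closure P.simple) :
    x = 0 ∨ 0 < P.functional x := by
  induction hx using AddSubmonoid.closure_induction with
  | mem x hx => exact .inr hx.1.2
  | zero => exact .inl rfl
  | add x y _ _ hx hy =>
    rcases hx with rfl | hx
    · simpa using hy
    · rcases hy with rfl | hy
      · simpa using Or.inr hx
      · right; rw [map_add]; linarith

/-- Nonnegative combinations of simple roots cannot cancel outside `A`. -/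
theorem Positivity.mem_span_of_add_mem_span (hA : A ⊆ P.simple) {x y : V}
    (hx : x ∈ AddSubmonoid.closure P.simple) (hy : y ∈ AddSubmonoid.closure P.simple)
    (hxy : x + y ∈ Submodule.span ℝ A) : x ∈ Submodule.span ℝ A := by
  have hmono : AddSubmonoid.closure (P.simple \ A) ≤ AddSubmonoid.closure P.simple :=
    AddSubmonoid.closure_mono Set.sdiff_subset
  rw [← Set.union_sdiff_cancel hA, AddSubmonoid.closure_union] at hx hy
  obtain ⟨x₁, hx₁, x₂, hx₂, rfl⟩ := AddSubmonoid.mem_sup.mp hx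
  obtain ⟨y₁, hy₁, y₂, hy₂, rfl⟩ := AddSubmonoid.mem_sup.mp hy
  have hx₁' := closure_le_span A hx₁
  have hy₁' := closure_le_span A hy₁
  have h0 : x₂ + y₂ = 0 := Submodule.disjoint_def.mp (P.disjoint_span_simple_diff hA) _
    (by
      have := sub_mem hxy (add_mem hx₁' hy₁')
      rwa [show x₁ + x₂ + (y₁ + y₂) - (x₁ + y₁) = x₂ + y₂ by abel] at this)
    (closure_le_span _ (add_mem hx₂ hy₂))
  have hx₂0 : x₂ = 0 := by
    rcases P.eq_zero_or_functional_pos (hmono hx₂) with h | h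
    · exact h
    rcases P.eq_zero_or_functional_pos (hmono hy₂) with h' | h'
    · simpa [h'] using h0
    · have := congrArg P.functional h0
      rw [map_add, map_zero] at this
      linarith
  simpa [hx₂0] using hx₁'

/-- A root congruent modulo `span A` to a positive root outside `span A` is positive. -/
theorem Positivity.mem_positive_of_sub_mem_span (hA : A ⊆ P.simple) {γ μ : V}
    (hγ : γ ∈ P.positive) (hγA : γ ∉ Submodule.span ℝ A) (hμ : μ ∈ S.roots)
    (h : μ - γ ∈ Submodule.span ℝ A) : μ ∈ P.positive := by
  by_contra hn
  refine hγA (P.mem_span_of_add_mem_span hA (P.positive_subset_closure hγ)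
    (P.positive_subset_closure (P.neg_mem_positive hμ hn)) ?_)
  simpa [sub_eq_add_neg, add_comm] using Submodule.neg_mem _ h

theorem Positivity.notMem_span_of_mem_notSpanned {Φ : Finset V} (hΦ : (Φ : Set V) ⊆ P.simple)
    {γ : V} (hγ : γ ∈ P.notSpanned Φ) : γ ∉ Submodule.span ℝ (Φ : Set V) := fun h =>
  hγ.2 ⟨hγ.1.1, P.mem_int_span_of_mem_span hΦ (P.roots_subset_int_span hγ.1.1) h⟩

end Span

theorem mem_string_iff (P : S.Positivity) {Φ : Finset V} (hΦ : (Φ : Set V) ⊆ P.simple) {γ μ : V}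
    (hγ : γ ∈ S.roots) (hγΦ : γ ∉ Submodule.span ℝ (Φ : Set V)) :
    μ ∈ S.string Φ γ ↔ μ ∈ S.roots ∧ μ - γ ∈ Submodule.span ℝ (Φ : Set V) := by
  constructor
  · rintro ⟨hμ, n, rfl⟩
    have hn : ∑ α ∈ Φ, n α • α ∈ Submodule.span ℝ (Φ : Set V) :=
      sum_mem fun α hα => zsmul_mem (Submodule.subset_span hα) _
    refine ⟨hμ.resolve_right fun h0 => hγΦ ?_, by simpa using hn⟩
    rw [eq_neg_of_add_eq_zero_left h0]
    exact Submodule.neg_mem _ hn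
  · rintro ⟨hμ, h⟩
    have h1 := P.mem_int_span_of_mem_span hΦ
      (sub_mem (P.roots_subset_int_span hμ) (P.roots_subset_int_span hγ)) h
    obtain ⟨n, -, hn⟩ := Submodule.mem_span_finset.mp h1
    exact ⟨.inl hμ, n, by rw [hn]; abel⟩

/-! ### Lowest roots -/

/-- The root `γ`, outside the real span of `A`, is lowest for `A`: subtracting an element of `A`
never gives a root. -/
structure IsLowest (S : AbstractRootSystem V) (A : Set V) (γ : V) : Prop where
  mem_roots : γ ∈ S.roots
  notMem_span : γ ∉ Submodule.span ℝ A
  sub_notMem : ∀ α ∈ A, γ - α ∉ S.roots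

theorem ne_of_sub_mem_span {A : Set V} {γ μ x : V} (hγ : γ ∉ Submodule.span ℝ A)
    (h : μ - γ ∈ Submodule.span ℝ A) (hx : x ∈ Submodule.span ℝ A) : μ ≠ x := by
  rintro rfl
  exact hγ (by simpa using sub_mem hx h)

theorem IsLowest.inner_nonpos {A : Set V} {γ α : V} (h : S.IsLowest A γ) (hα : α ∈ A)
    (hαS : α ∈ S.roots) : ⟪γ, α⟫_ℝ ≤ 0 := by
  by_contra! hpos
  refine h.sub_notMem α hα (S.sub_mem_of_inner_pos h.mem_roots hαS ?_ hpos)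
  rintro rfl
  exact h.notMem_span (Submodule.subset_span hα)

/-- If subtracting some positive root `p` in `span A` from `γ` gives a root, so does subtracting
some element of `A`. -/
theorem exists_sub_simple_mem (P : S.Positivity) {A : Set V} (hA : A ⊆ P.simple) {γ p : V}
    (hγ : ∀ α ∈ A, ⟪γ, α⟫_ℝ ≤ 0) (hγA : γ ∉ Submodule.span ℝ A) (hp : p ∈ P.positive)
    (hpA : p ∈ Submodule.span ℝ A) (hγp : γ - p ∈ S.roots) : ∃ α ∈ A, γ - α ∈ S.roots := by
  let T : Set V := {p | p ∈ P.positive ∧ p ∈ Submodule.span ℝ A ∧ γ - p ∈ S.roots}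
  obtain ⟨p, ⟨hp, hpA, hγp⟩, hmin⟩ := Set.exists_min_image T P.functional
    (S.finite_roots.subset fun α hα => hα.1.1) ⟨p, hp, hpA, hγp⟩
  obtain ⟨α, hα, hpos⟩ : ∃ α ∈ A, 0 < ⟪p, α⟫_ℝ := by
    by_contra! hcon
    have : ∀ x ∈ AddSubmonoid.closure A, ⟪p, x⟫_ℝ ≤ 0 := fun x hx => by
      induction hx using AddSubmonoid.closure_induction with
      | mem x hx => exact hcon x hx
      | zero => simp
      | add x y _ _ hx hy => rw [inner_add_right]; linarith
    have := real_inner_self_nonpos.mp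
      (this p (P.mem_closure_of_mem_span hA (P.positive_subset_closure hp) hpA))
    exact S.zero_notMem (this ▸ hp.1)
  by_cases hpα : p = α
  · exact ⟨α, hα, hpα ▸ hγp⟩
  exfalso
  have hαA : α ∈ Submodule.span ℝ A := Submodule.subset_span hα
  have hαS := (hA hα).1.1
  have h1 : p - α ∈ S.roots := S.sub_mem_of_inner_pos hp.1 hαS hpα hpos
  have h2 : p - α ∈ P.positive := by
    by_contra hn
    exact (hA hα).2 ⟨-(p - α), P.neg_mem_positive h1 hn, p, hp, by abel⟩
  have h3 : γ - p + α ∈ S.roots := by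
    refine add_mem_of_inner_neg hαS hγp ?_ ?_
    · exact ne_of_sub_mem_span hγA (by simpa using hpA) (Submodule.neg_mem _ hαA)
    · have := hγ α hα
      rw [real_inner_comm, inner_sub_left]; linarith
  have := hmin (p - α) ⟨h2, sub_mem hpA hαA, by rwa [← sub_add]⟩
  have := (hA hα).1.2
  rw [map_sub] at *
  linarith

theorem IsLowest.inner_pos [FiniteDimensional ℝ V] (P : S.Positivity) {A : Set V}
    (hA : A ⊆ P.simple) {γ ν : V} (hγ : S.IsLowest A γ) (hν : S.IsLowest A ν)
    (h : ν - γ ∈ Submodule.span ℝ A) : 0 < ⟪γ, ν⟫_ℝ := by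
  obtain ⟨u, hu, z, hz, rfl⟩ := (Submodule.span ℝ A).exists_add_mem_mem_orthogonal γ
  -- `γ = u + z` and `ν = w + z`, with `u` and `w` in `span A` and `z` orthogonal to it
  obtain ⟨w, rfl⟩ : ∃ w, ν = w + z := ⟨ν - z, by abel⟩
  have hw : w ∈ Submodule.span ℝ A := by
    have := add_mem h hu
    rwa [show w + z - (u + z) + u = w by abel] at this
  have hz0 : z ≠ 0 := by
    rintro rfl
    exact hγ.notMem_span (by simpa using hu)
  have hzA : ∀ x ∈ Submodule.span ℝ A, ⟪z, x⟫_ℝ = 0 := fun x hx =>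
    (Submodule.mem_orthogonal' _ z).mp hz x hx
  have key : ∀ v, S.IsLowest A (v + z) → ∀ α ∈ A, ⟪v, α⟫_ℝ ≤ 0 := fun v hv α hα => by
    have := hv.inner_nonpos hα (hA hα).1.1
    rwa [inner_add_left, hzA α (Submodule.subset_span hα), add_zero] at this
  have huw : 0 ≤ ⟪u, w⟫_ℝ := inner_nonneg_of_mem_span_of_antidominant
    (fun α hα β hβ hne => P.inner_simple_nonpos (hA hα) (hA hβ) hne) hu (key u hγ) (key w hν)
  have hzz : 0 < ⟪z, z⟫_ℝ := real_inner_self_pos.mpr hz0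
  rw [inner_add_left, inner_add_right, inner_add_right, hzA w hw, real_inner_comm z u,
    hzA u hu]
  linarith

/-- A coset of `span A` contains at most one lowest root. -/
theorem IsLowest.eq [FiniteDimensional ℝ V] (P : S.Positivity) {A : Set V} (hA : A ⊆ P.simple)
    {γ ν : V} (hγ : S.IsLowest A γ) (hν : S.IsLowest A ν) (h : ν - γ ∈ Submodule.span ℝ A) :
    γ = ν := by
  by_contra hne
  have hroot := S.sub_mem_of_inner_pos hγ.mem_roots hν.mem_roots hne (hγ.inner_pos P hA hν h)
  have key : ∀ {x y : V}, S.IsLowest A x → S.IsLowest A y → x - y ∈ Submodule.span ℝ A →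
      x - y ∉ P.positive := fun {x y} hx hy hxy hpos => by
    obtain ⟨α, hα, hxα⟩ := exists_sub_simple_mem P hA
      (fun α hα => hx.inner_nonpos hα (hA hα).1.1) hx.notMem_span hpos hxy
      (by simpa using hy.mem_roots)
    exact hx.sub_notMem α hα hxα
  by_cases hpos : γ - ν ∈ P.positive
  · exact key hγ hν (by simpa using Submodule.neg_mem _ h) hpos
  · exact key hν hγ h (by simpa using P.neg_mem_positive hroot hpos)

/-- Induction over the roots of `γ + span A`, starting from the lowest root `γ`. -/
theorem IsLowest.induction [FiniteDimensional ℝ V] (P : S.Positivity) {A : Set V}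
    (hA : A ⊆ P.simple) {γ : V} (hγ : S.IsLowest A γ) {C : V → Prop} (base : C γ)
    (step : ∀ ν ∈ S.roots, ν - γ ∈ Submodule.span ℝ A → ∀ α ∈ A, ν - α ∈ S.roots →
      (∀ c : ℝ, 0 < c → ν - c • α ∈ S.roots → C (ν - c • α)) → C ν)
    {ν : V} (hν : ν ∈ S.roots) (hνγ : ν - γ ∈ Submodule.span ℝ A) : C ν := by
  by_contra hC
  let T : Set V := {ν | ν ∈ S.roots ∧ ν - γ ∈ Submodule.span ℝ A ∧ ¬ C ν}
  obtain ⟨ν, ⟨hν, hνγ, hC⟩, hmin⟩ := Set.exists_min_image T P.functional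
    (S.finite_roots.subset fun α hα => hα.1) ⟨ν, hν, hνγ, hC⟩
  obtain ⟨α, hα, hνα⟩ : ∃ α ∈ A, ν - α ∈ S.roots := by
    by_contra! hcon
    have hlow : S.IsLowest A ν :=
      ⟨hν, fun h => ne_of_sub_mem_span hγ.notMem_span hνγ h rfl, hcon⟩
    exact hC (hγ.eq P hA hlow hνγ ▸ base)
  refine hC (step ν hν hνγ α hα hνα fun c hc hcν => ?_)
  by_contra hC'
  have h1 := hmin (ν - c • α) ⟨hcν, ?_, hC'⟩
  · have h2 := mul_pos hc (hA hα).1.2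
    rw [map_sub, map_smul, smul_eq_mul] at h1
    linarith
  · rw [sub_right_comm]
    exact sub_mem hνγ (Submodule.smul_mem _ _ (Submodule.subset_span hα))

/-! ### Minimum level -/

theorem Positivity.level_sub (P : S.Positivity) (v w : V) :
    P.level (v - w) = P.level v - P.level w := by
  rw [Positivity.level, map_sub, Finsupp.sum_sub_index fun _ _ _ => rfl]
  rfl

theorem Positivity.level_simple (P : S.Positivity) {α : V} (hα : α ∈ P.simple) :
    P.level α = 1 := by
  simpa using P.level_sum {α} (by simpa using hα) fun _ => 1

theorem Positivity.IsMinLevel.isLowest {P : S.Positivity} {Φ : Finset V}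
    (hΦ : (Φ : Set V) ⊆ P.simple) {γ : V} (hγ : γ ∉ Submodule.span ℝ (Φ : Set V))
    (h : P.IsMinLevel Φ γ) : S.IsLowest Φ γ := by
  refine ⟨h.1, hγ, fun α hα hγα => ?_⟩
  have h1 := h.2 (γ - α) ((mem_string_iff P hΦ h.1 hγ).mpr ⟨hγα, ?_⟩) hγα
  · rw [P.level_sub, P.level_simple (hΦ hα)] at h1
    linarith
  · simpa using Submodule.subset_span hα

theorem isMinLevel_iff_isLowest [FiniteDimensional ℝ V] (P : S.Positivity) {Φ : Finset V}
    (hΦ : (Φ : Set V) ⊆ P.simple) {γ : V} (hγ : γ ∉ Submodule.span ℝ (Φ : Set V)) :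
    P.IsMinLevel Φ γ ↔ S.IsLowest Φ γ := by
  refine ⟨fun h => h.isLowest hΦ hγ, fun h => ⟨h.mem_roots, fun μ hμ hμS => ?_⟩⟩
  refine h.induction P hΦ (C := fun ν => P.level γ ≤ P.level ν) le_rfl ?_ hμS
    ((mem_string_iff P hΦ h.mem_roots hγ).mp hμ).2
  intro ν _ _ α hα hνα ih
  have := ih 1 one_pos (by simpa using hνα)
  rw [one_smul, P.level_sub, P.level_simple (hΦ hα)] at this
  linarith

/-! ### Strings of orthogonal sets of simple roots -/

section Orthogonal

variable [FiniteDimensional ℝ V] (P : S.Positivity)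

theorem IsLowest.add_add_mem {A : Set V} (hA : A ⊆ P.simple) {γ a b : V} (hγ : S.IsLowest A γ)
    (ha : a ∈ Submodule.span ℝ A) (hγa : γ + a ∈ S.roots) (hγb : γ + b ∈ S.roots)
    (hb : ∀ α ∈ A, ⟪α, b⟫_ℝ = 0) (hγbA : γ + b ∉ Submodule.span ℝ A) :
    γ + a + b ∈ S.roots := by
  refine hγ.induction P hA (C := fun ν => ν + b ∈ S.roots) hγb ?_ hγa (by simpa using ha)
  intro ν hν hνγ α hα hνα ih
  refine add_mem_roots_of_orthogonal (hA hα).1.1 (hb α hα) hν hνα ?_ ih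
  exact ne_of_sub_mem_span hγbA (by simpa using hνγ) (zero_mem _)

theorem IsLowest.add_mem_of_add_add_mem {A B : Set V} (hA : A ⊆ P.simple) (hB : B ⊆ P.simple)
    (hAB : ∀ α ∈ A, ∀ β ∈ B, ⟪α, β⟫_ℝ = 0) {γ a b : V} (hγ : S.IsLowest (A ∪ B) γ)
    (ha : a ∈ Submodule.span ℝ A) (hb : b ∈ Submodule.span ℝ B)
    (h : γ + a + b ∈ S.roots) : γ + a ∈ S.roots := by
  have horth : Submodule.span ℝ A ⟂ Submodule.span ℝ B :=
    Submodule.isOrtho_span.mpr fun α hα β hβ => hAB α hα β hβ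
  have hA' : Submodule.span ℝ A ≤ Submodule.span ℝ (A ∪ B) :=
    Submodule.span_mono Set.subset_union_left
  have hB' : Submodule.span ℝ B ≤ Submodule.span ℝ (A ∪ B) :=
    Submodule.span_mono Set.subset_union_right
  let C : V → Prop := fun ν => ∀ a ∈ Submodule.span ℝ A, ∀ b ∈ Submodule.span ℝ B,
    ν = γ + a + b → γ + a ∈ S.roots
  refine hγ.induction P (Set.union_subset hA hB) (C := C) ?_ ?_ h ?_ a ha b hb rfl
  · intro a ha b hb hab
    have h0 : a + b = 0 := by simpa [add_assoc] using hab.symm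
    have hab' : a = -b := eq_neg_of_add_eq_zero_left h0
    have ha0 : a = 0 := Submodule.disjoint_def.mp horth.disjoint a ha
      (hab' ▸ Submodule.neg_mem _ hb)
    simpa [ha0] using hγ.mem_roots
  · rintro ν hν hνγ α (hα | hα) hνα ih a ha b hb rfl
    · have h1 : ⟪α, -b⟫_ℝ = 0 := by
        rw [inner_neg_right, horth.inner_eq (Submodule.subset_span hα) hb, neg_zero]
      have h2 := add_mem_roots_of_orthogonal (hA hα).1.1 h1 hν hνα ?_ ?_
      · simpa using h2
      · rw [add_neg_cancel_right]
        exact ne_of_sub_mem_span hγ.notMem_span (by simpa using hA' ha) (zero_mem _)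
      · intro c hc hcν
        have := ih c hc hcν (a - c • α)
          (sub_mem ha (Submodule.smul_mem _ _ (Submodule.subset_span hα))) b hb (by abel)
        convert this using 1
        abel
    · exact ih 1 one_pos (by simpa using hνα) a ha (b - α)
        (sub_mem hb (Submodule.subset_span hα)) (by rw [one_smul]; abel)
  · rw [add_assoc, add_sub_cancel_left]
    exact add_mem (hA' ha) (hB' hb)

end Orthogonal

end AbstractRootSystem

open AbstractRootSystem in
theorem mainTheorem4 {V : Type*} [NormedAddCommGroup V] [InnerProductSpace ℝ V]
    [FiniteDimensional ℝ V] (S : AbstractRootSystem V) (P : S.Positivity)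
    (n : ℕ) (hn : 1 ≤ n) (Φ : Finset V) (Φs : Fin n → Finset V)
    (hsimple : ∀ k, (Φs k : Set V) ⊆ P.simple)
    (hconn : ∀ k, AbstractRootSystem.IsConnectedSubset (Φs k : Set V))
    (horth : ∀ i j, i ≠ j → ∀ α ∈ Φs i, ∀ β ∈ Φs j, ⟪α, β⟫_ℝ = 0)
    (hunion : (Φ : Set V) = ⋃ k, (Φs k : Set V))
    (hproper : (Φ : Set V) ⊂ P.simple)
    (lam : V) (hlam : lam ∈ P.notSpanned Φ) (hmin : P.IsMinLevel Φ lam) :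
    (∀ k, S.string (Φs k) lam ⊆ P.positive) ∧
    S.string Φ lam =
      {μ | ∃ γ : Fin n → V,
        (∀ k, γ k ∈ Submodule.span ℝ (Φs k : Set V) ∧ lam + γ k ∈ S.string (Φs k) lam) ∧
        μ = lam + ∑ k, γ k} ∧
    ∀ γ ∈ P.notSpanned Φ, P.IsMinLevel Φ γ ↔ ∀ k, P.IsMinLevel (Φs k) γ := by
  have hΦ : (Φ : Set V) ⊆ P.simple := hproper.1
  have hsub : ∀ k, (Φs k : Set V) ⊆ Φ := fun k => hunion ▸ Set.subset_iUnion_of_subset k subset_rfl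
  have hle : ∀ k, Submodule.span ℝ (Φs k : Set V) ≤ Submodule.span ℝ (Φ : Set V) := fun k =>
    Submodule.span_mono (hsub k)
  have hnot : ∀ γ ∈ P.notSpanned Φ, γ ∉ Submodule.span ℝ (Φ : Set V) := fun γ hγ =>
    P.notMem_span_of_mem_notSpanned hΦ hγ
  have hlamΦ := hnot lam hlam
  have hlamk : ∀ k, lam ∉ Submodule.span ℝ (Φs k : Set V) := fun k h => hlamΦ (hle k h)
  have hlow : S.IsLowest Φ lam := hmin.isLowest hΦ hlamΦ
  have hlowk : ∀ k, S.IsLowest (Φs k) lam := fun k =>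
    ⟨hlow.mem_roots, hlamk k, fun α hα => hlow.sub_notMem α (hsub k hα)⟩
  have hortho : ∀ i j, i ≠ j → ∀ α ∈ Φs i, ∀ x ∈ Submodule.span ℝ (Φs j : Set V),
      ⟪α, x⟫_ℝ = 0 := fun i j hij α hα x hx =>
    (Submodule.isOrtho_span.mpr fun α hα β hβ => horth i j hij α hα β hβ).inner_eq
      (Submodule.subset_span hα) hx
  refine ⟨fun k μ hμ => ?_, Set.ext fun μ => ?_, fun γ hγ => ?_⟩
  · obtain ⟨h1, h2⟩ := (mem_string_iff P (hsimple k) hlow.mem_roots (hlamk k)).mp hμ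
    exact P.mem_positive_of_sub_mem_span (hsimple k) hlam.1 (hlamk k) h1 h2
  · rw [mem_string_iff P hΦ hlow.mem_roots hlamΦ, Set.mem_ofPred_eq]
    simp only [fun k ν => mem_string_iff P (μ := ν) (hsimple k) hlow.mem_roots (hlamk k),
      add_sub_cancel_left]
    constructor
    · rintro ⟨hμ, hμΦ⟩
      rw [hunion, Submodule.span_iUnion, Submodule.mem_iSup_iff_exists_finsupp] at hμΦ
      obtain ⟨f, hf, hsum⟩ := hμΦ
      rw [Finsupp.sum_fintype _ _ fun _ => rfl] at hsum
      have hμeq : μ = lam + ∑ k, f k := by rw [hsum]; abel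
      refine ⟨f, fun k => ⟨hf k, ?_, hf k⟩, hμeq⟩
      let B : Set V := ⋃ j ∈ {j | j ≠ k}, (Φs j : Set V)
      have hAB : (Φ : Set V) = (Φs k : Set V) ∪ B := by
        rw [hunion]
        refine Set.Subset.antisymm (Set.iUnion_subset fun j => ?_) (Set.union_subset
          (Set.subset_iUnion_of_subset k subset_rfl)
          (Set.iUnion₂_subset fun j _ => Set.subset_iUnion_of_subset j subset_rfl))
        rcases eq_or_ne j k with rfl | hj
        · exact Set.subset_union_left
        · exact (Set.subset_biUnion_of_mem (u := fun j => (Φs j : Set V)) hj).trans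
            Set.subset_union_right
      refine IsLowest.add_mem_of_add_add_mem P (A := Φs k) (B := B) (hsimple k)
        (Set.iUnion₂_subset fun j _ => hsimple j) ?_ (hAB ▸ hlow) (hf k)
        (b := ∑ j ∈ Finset.univ.erase k, f j) ?_ ?_
      · intro α hα β hβ
        obtain ⟨j, hj, hβ⟩ := Set.mem_iUnion₂.mp hβ
        exact horth k j (Ne.symm hj) α hα β hβ
      · exact sum_mem fun j hj => Submodule.span_mono
          (Set.subset_biUnion_of_mem (u := fun j => (Φs j : Set V))
            (Finset.ne_of_mem_erase hj)) (hf j)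
      · rwa [add_assoc, Finset.add_sum_erase _ _ (Finset.mem_univ k), ← hμeq]
    · rintro ⟨f, hf, rfl⟩
      have hsumΦ : ∀ s : Finset (Fin n), ∑ k ∈ s, f k ∈ Submodule.span ℝ (Φ : Set V) := fun s =>
        sum_mem fun k _ => hle k (hf k).1
      refine ⟨?_, by simpa using hsumΦ Finset.univ⟩
      -- the components are added one at a time
      suffices h : ∀ s : Finset (Fin n), lam + ∑ k ∈ s, f k ∈ S.roots from h _
      intro s
      induction s using Finset.induction_on with
      | empty => simpa using hlow.mem_roots
      | insert k s hk ih =>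
        rw [Finset.sum_insert hk, ← add_assoc]
        refine (hlowk k).add_add_mem P (hsimple k) (hf k).1 (hf k).2.1 ih ?_ ?_
        · intro α hα
          rw [inner_sum]
          refine Finset.sum_eq_zero fun j hj => hortho k j ?_ α hα _ (hf j).1
          rintro rfl
          exact hk hj
        · exact fun h => ne_of_sub_mem_span hlamΦ (by simpa using hsumΦ s) (hle k h) rfl
  · have hγk : ∀ k, γ ∉ Submodule.span ℝ (Φs k : Set V) := fun k h => hnot γ hγ (hle k h)
    rw [isMinLevel_iff_isLowest P hΦ (hnot γ hγ)]
    simp only [fun k => isMinLevel_iff_isLowest P (hsimple k) (hγk k)]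
    refine ⟨fun h k => ⟨h.mem_roots, hγk k, fun α hα => h.sub_notMem α (hsub k hα)⟩,
      fun h => ⟨hγ.1.1, hnot γ hγ, fun α hα => ?_⟩⟩
    rw [hunion] at hα
    obtain ⟨k, hk⟩ := Set.mem_iUnion.mp hα
    exact (h k).sub_notMem α hk
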